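/- Let $m,n\ge 1$ be integers, $0<s<1$ and $N=m+n$. For $\alpha>0$ let $$E_\alpha=\{(u,v)\in\mathbb R^m\times\mathbb R^n : |v|>\alpha|u|\},\qquad C_\alpha=\{(u,v)\in\mathbb R^m\times\mathbb R^n : |v|=\alpha|u|\}.$$ For an open set $E\subset\mathbb R^N$ and $p\in\partial E$, the $s$-fractional mean curvature of $\partial E$ at $p$ is the principal value $$H^s_{\partial E}(p)=\lim_{\delta\to 0^+}\int_{\mathbb R^N\setminus B_\delta(p)}\frac{\chi_E(x)-\chi_{\mathbb R^N\setminus E}(x)}{|x-p|^{N+s}}\,dx .$$ Then $\partial E_\alpha=C_\alpha$ for every $\alpha>0$, and there is a unique $\alpha=\alpha(s,m,n)>0$ such that $C_\alpha=\partial E_\alpha$ is an $s$-minimal surface in $\mathbb R^N\setminus\{0\}$, that is, $C_\alpha\setminus\{0\}$ is a smooth hypersurface with $E_\alpha$ locally on one side of it, and $H^s_{C_\alpha}(p)$ exists and equals $0$ for every $p\in C_\alpha\setminus\{0\}$. -/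

import Mathlib

open Set Filter Topology MeasureTheory
open scoped ContDiff

noncomputable section

/-- The integrand `(χ_A(x) - χ_{Aᶜ}(x)) / |x - p| ^ (N + s)`, where `N = dim V`. -/
def fracKernel {V : Type*} [NormedAddCommGroup V] [InnerProductSpace ℝ V]
    (s : ℝ) (A : Set V) (p x : V) : ℝ :=
  (A.indicator (fun _ => (1 : ℝ)) x - Aᶜ.indicator (fun _ => (1 : ℝ)) x) /
    ‖x - p‖ ^ ((Module.finrank ℝ V : ℝ) + s)

/-- The `s`-fractional mean curvature of `∂A` at `p` exists as a principal value
`lim_{δ → 0⁺} ∫_{|x - p| ≥ δ} (χ_A(x) - χ_{Aᶜ}(x)) / |x - p| ^ (N + s) dx`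
and is equal to `h`. -/
def HasFracMeanCurvature {V : Type*} [NormedAddCommGroup V] [InnerProductSpace ℝ V]
    [FiniteDimensional ℝ V] [MeasurableSpace V] [BorelSpace V]
    (s : ℝ) (A : Set V) (p : V) (h : ℝ) : Prop :=
  (∀ δ : ℝ, 0 < δ → IntegrableOn (fracKernel s A p) (Metric.ball p δ)ᶜ volume) ∧
  Tendsto (fun δ : ℝ => ∫ x in (Metric.ball p δ)ᶜ, fracKernel s A p x ∂volume)
    (𝓝[>] 0) (𝓝 h)

/-- `∂A ∩ Ω` is a smooth embedded hypersurface with `A` locally on one side of it. -/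
def HasSmoothBoundaryIn {V : Type*} [NormedAddCommGroup V] [InnerProductSpace ℝ V]
    (A Ω : Set V) : Prop :=
  ∀ p ∈ frontier A ∩ Ω, ∃ (U : Set V) (g : V → ℝ), IsOpen U ∧ p ∈ U ∧
    ContDiffOn ℝ ∞ g U ∧ fderiv ℝ g p ≠ 0 ∧ ∀ x ∈ U, (x ∈ A ↔ 0 < g x)

/-- The boundary `∂A` of the open set `A` is an `s`-minimal surface in `Ω`: it is regular in `Ω`
and its `s`-fractional mean curvature vanishes at every point of `∂A ∩ Ω`. -/
structure IsFracMinimalBoundaryIn {V : Type*} [NormedAddCommGroup V] [InnerProductSpace ℝ V]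
    [FiniteDimensional ℝ V] [MeasurableSpace V] [BorelSpace V]
    (s : ℝ) (A Ω : Set V) : Prop where
  isOpen : IsOpen A
  smooth : HasSmoothBoundaryIn A Ω
  curvature_eq_zero : ∀ p ∈ frontier A ∩ Ω, HasFracMeanCurvature s A p 0

/-- `ℝ^m × ℝ^n = ℝ^(m+n)` with the Euclidean norm. -/
abbrev EucProd (m n : ℕ) : Type :=
  WithLp 2 (EuclideanSpace ℝ (Fin m) × EuclideanSpace ℝ (Fin n))

/-- The Lawson cone `{(u, v) : |v| = α |u|}`. -/
def lawsonCone (m n : ℕ) (α : ℝ) : Set (EucProd m n) :=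
  {x | ‖x.snd‖ = α * ‖x.fst‖}

/-- The solid cone `{(u, v) : |v| > α |u|}`, whose boundary is the Lawson cone. -/
def solidCone (m n : ℕ) (α : ℝ) : Set (EucProd m n) :=
  {x | α * ‖x.fst‖ < ‖x.snd‖}

end

/-! At a cone point `p = (a, b)`, translate `p` to the origin and average the `±1` integrand over
the four reflections `(±η, ±ξ)`. These preserve `‖z‖` and every ball about `0`, so no truncated
integral changes. A similarity on each factor then carries `(e, f)` to `(a, b)`. The sign becomes
`symSign e f 1`, which does not depend on `α`, and all dependence on `α` moves into the anisotropic
kernel `coneKernel k α` with `k = N + s`. The curvature at `p` is thus a positive multiple of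
`coneProfile e f k α` (`exists_pos_hasFracMeanCurvature`), and the theorem reduces to a unique zero
of this function of one variable.

Convergence: opposite reflections cancel the first-order part of the sign, so `symSign` lives near
two hyperplanes, within a distance quadratic in `‖z‖`. This set has volume `O(r ^ (N + 1))` in the
ball of radius `r`, and `k < N + 1`.

Uniqueness: `symSign` is nonnegative where `‖η‖ < ‖ξ‖`, where the kernel decreases in `α`, and
nonpositive elsewhere, where the kernel increases (`symSign_mul_coneKernel_anti`). Hence the profile
is strictly decreasing.

Existence: the profile is continuous, and the kernel concentrates near `η = 0` as `α → 0` and near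
`ξ = 0` as `α → ∞`. This makes the profile positive for some small `α` and negative for some large
one. -/

/-! ### Slab volumes and integrability of power kernels. -/

section Slab

variable {V : Type*} [NormedAddCommGroup V] [InnerProductSpace ℝ V]
  [FiniteDimensional ℝ V] [MeasurableSpace V] [BorelSpace V]

/-- A slab of width `2ε` in the ball of radius `r` has volume at most a multiple of `ε r^(N-1)`. -/
theorem mul_volume_slab_le {w w' : V} (hw : inner ℝ w w' = 1) (r ε : ℝ) :
    ENNReal.ofReal r * volume {z : V | ‖z‖ < r ∧ |inner ℝ w z| ≤ ε} ≤
      ENNReal.ofReal (2 * ε) * volume (Metric.ball (0 : V) (r * (1 + ‖w'‖))) := by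
  set A : Set V := {z : V | ‖z‖ < r ∧ |inner ℝ w z| ≤ ε} with hA
  have hAm : MeasurableSet A :=
    (measurableSet_lt measurable_norm measurable_const).inter
      (measurableSet_le (by fun_prop : Continuous fun z : V => |inner ℝ w z|).measurable
        measurable_const)
  -- Average over the translates `A + t • w'` with `0 ≤ t ≤ r`. Since `⟪w, z - t • w'⟫ = ⟪w, z⟫ -
  -- t`, a given `z` lies in them only for `t` in an interval of length `2ε`; Tonelli then gives the
  -- bound.
  have h1 : ENNReal.ofReal r * volume A =
      ∫⁻ t in Icc (0 : ℝ) r, ∫⁻ z : V, A.indicator 1 (z - t • w') := by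
    have h : ∀ t : ℝ, ∫⁻ z : V, A.indicator (1 : V → ENNReal) (z - t • w') = volume A := by
      intro t
      rw [lintegral_sub_right_eq_self (fun z => A.indicator (1 : V → ENNReal) z) (t • w'),
        lintegral_indicator_one hAm]
    simp only [h]
    rw [lintegral_const, Measure.restrict_apply_univ, Real.volume_Icc, sub_zero, mul_comm]
  have hmeas : Measurable fun q : ℝ × V => A.indicator (1 : V → ENNReal) (q.2 - q.1 • w') :=
    (measurable_one.indicator hAm).comp (by fun_prop)
  rw [h1, lintegral_lintegral_swap hmeas.aemeasurable]
  calc ∫⁻ z : V, ∫⁻ t in Icc (0 : ℝ) r, A.indicator 1 (z - t • w')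
      ≤ ∫⁻ z : V, (Metric.ball (0 : V) (r * (1 + ‖w'‖))).indicator
          (fun _ => ENNReal.ofReal (2 * ε)) z := by
        refine lintegral_mono fun z => ?_
        by_cases hz : z ∈ Metric.ball (0 : V) (r * (1 + ‖w'‖))
        · rw [indicator_of_mem hz]
          calc ∫⁻ t in Icc (0 : ℝ) r, A.indicator 1 (z - t • w')
              ≤ ∫⁻ t in Icc (0 : ℝ) r, (Icc (inner ℝ w z - ε) (inner ℝ w z + ε)).indicator 1 t := by
                refine lintegral_mono fun t => ?_
                by_cases hmem : z - t • w' ∈ A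
                · have h2 := abs_le.1 hmem.2
                  rw [inner_sub_right, inner_smul_right, hw, mul_one] at h2
                  rw [indicator_of_mem (show t ∈ Icc _ _ from
                    ⟨by linarith [h2.2], by linarith [h2.1]⟩)]
                  exact indicator_le_self' (fun _ _ => zero_le) _
                · rw [indicator_of_notMem hmem]
                  exact zero_le
            _ ≤ ∫⁻ t, (Icc (inner ℝ w z - ε) (inner ℝ w z + ε)).indicator 1 t :=
                setLIntegral_le_lintegral _ _
            _ = ENNReal.ofReal (2 * ε) := by
                rw [lintegral_indicator_one measurableSet_Icc, Real.volume_Icc]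
                congr 1; ring
        · rw [indicator_of_notMem hz]
          refine le_of_eq ?_
          refine (setLIntegral_congr_fun measurableSet_Icc fun t ht => ?_).trans lintegral_zero
          refine indicator_of_notMem (fun hmem => hz ?_) _
          have h2 : ‖z‖ ≤ ‖z - t • w'‖ + ‖t • w'‖ := by
            simpa using norm_add_le (z - t • w') (t • w')
          have h3 : ‖t • w'‖ ≤ r * ‖w'‖ := by
            rw [norm_smul, Real.norm_of_nonneg ht.1]
            exact mul_le_mul_of_nonneg_right ht.2 (norm_nonneg _)
          rw [mem_ball_zero_iff]
          have := hmem.1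
          linarith
    _ = _ := by
        rw [lintegral_indicator_const measurableSet_ball]

/-- If `S` has density `O(r)` at the origin, then the singular kernel `‖z‖^(-k)` with
`N < k < N + 1` is integrable on `S`. -/
theorem setLIntegral_norm_rpow_lt_top {S : Set V} {C k : ℝ}
    (hS : ∀ r : ℝ, 0 < r →
      volume (Metric.ball (0 : V) r ∩ S) ≤ ENNReal.ofReal (C * r ^ ((Module.finrank ℝ V : ℝ) + 1)))
    (hk : (Module.finrank ℝ V : ℝ) < k) (hk' : k < (Module.finrank ℝ V : ℝ) + 1) :
    ∫⁻ z in S, ENNReal.ofReal (‖z‖ ^ (-k)) < ⊤ := by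
  set N : ℝ := (Module.finrank ℝ V : ℝ) with hN
  have hN0 : 0 ≤ N := Nat.cast_nonneg _
  have hk0 : 0 < k := lt_of_le_of_lt hN0 hk
  rw [lintegral_eq_lintegral_meas_lt _
    (Eventually.of_forall fun z => Real.rpow_nonneg (norm_nonneg z) _) (by fun_prop)]
  have hsub : ∀ t : ℝ, 0 < t → {z : V | t < ‖z‖ ^ (-k)} ⊆ Metric.ball 0 (t ^ (-(1 / k))) := by
    intro t ht z hz
    rw [mem_ball_zero_iff]
    have hz' : t < ‖z‖ ^ (-k) := hz
    have hz0 : 0 < ‖z‖ := by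
      rcases (norm_nonneg z).eq_or_lt with h | h
      · rw [← h, Real.zero_rpow (by linarith)] at hz'
        linarith
      · exact h
    have := Real.rpow_lt_rpow_of_neg ht hz' (show -(1 / k) < 0 by
      have : 0 < 1 / k := by positivity
      linarith)
    rwa [← Real.rpow_mul hz0.le, show -k * -(1 / k) = 1 by field_simp, Real.rpow_one] at this
  have hmeas : ∀ t : ℝ, MeasurableSet {z : V | t < ‖z‖ ^ (-k)} := fun t =>
    measurableSet_lt (by fun_prop) (by fun_prop)
  -- For `t ≤ 1` the full ball gives `t ^ (-N/k)`, integrable at `0` as `N < k`. For `t > 1` the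
  -- density of `S` gives `t ^ (-(N+1)/k)`, integrable at infinity as `k < N + 1`.
  rw [← Ioc_union_Ioi_eq_Ioi (zero_le_one' ℝ),
    lintegral_union measurableSet_Ioi Ioc_disjoint_Ioi_same]
  refine ENNReal.add_lt_top.2 ⟨?_, ?_⟩
  · obtain ⟨B, hB⟩ : ∃ B : ℝ, volume (Metric.ball (0 : V) 1) = ENNReal.ofReal B :=
      ⟨_, (ENNReal.ofReal_toReal measure_ball_lt_top.ne).symm⟩
    have hint : IntegrableOn (fun t : ℝ => t ^ (-(N / k)) * B) (Ioc 0 1) :=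
      ((intervalIntegrable_iff_integrableOn_Ioc_of_le zero_le_one).1
        (intervalIntegral.intervalIntegrable_rpow' (by
          have : N / k < 1 := (div_lt_one hk0).2 hk
          linarith))).mul_const B
    refine lt_of_le_of_lt (setLIntegral_mono' measurableSet_Ioc fun t ht => ?_)
      hint.lintegral_lt_top
    calc (volume.restrict S) {z : V | t < ‖z‖ ^ (-k)}
        ≤ volume (Metric.ball (0 : V) (t ^ (-(1 / k)))) :=
          (Measure.restrict_apply_le _ _).trans (measure_mono (hsub t ht.1))
      _ = ENNReal.ofReal (t ^ (-(N / k)) * B) := by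
          rw [Measure.addHaar_ball_of_pos _ _ (Real.rpow_pos_of_pos ht.1 _), hB,
            ← ENNReal.ofReal_mul (by have := ht.1; positivity), ← Real.rpow_natCast,
            ← Real.rpow_mul ht.1.le]
          congr 3
          rw [← hN]; ring
  · have hint : IntegrableOn (fun t : ℝ => C * t ^ (-((N + 1) / k))) (Ioi 1) :=
      (integrableOn_Ioi_rpow_of_lt (by
        have : 1 < (N + 1) / k := (one_lt_div hk0).2 hk'
        linarith) one_pos).const_mul C
    refine lt_of_le_of_lt (setLIntegral_mono' measurableSet_Ioi fun t ht => ?_)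
      hint.lintegral_lt_top
    have ht0 : (0 : ℝ) < t := lt_trans one_pos ht
    rw [Measure.restrict_apply (hmeas t)]
    refine (measure_mono (inter_subset_inter_left S (hsub t ht0))).trans
      ((hS _ (Real.rpow_pos_of_pos ht0 _)).trans (le_of_eq ?_))
    rw [← Real.rpow_mul ht0.le]
    congr 3
    ring

/-- `‖z‖^(-k)` is integrable away from the origin when `N < k`. -/
theorem integrableOn_norm_rpow_compl_ball {k : ℝ} (hk : (Module.finrank ℝ V : ℝ) < k)
    {δ : ℝ} (hδ : 0 < δ) :
    IntegrableOn (fun z : V => ‖z‖ ^ (-k)) (Metric.ball 0 δ)ᶜ := by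
  have hk0 : 0 < k := lt_of_le_of_lt (Nat.cast_nonneg _) hk
  -- The constant comes from `1 + ‖z‖ ≤ (1 + 1/δ) * ‖z‖` for `‖z‖ ≥ δ`.
  refine Integrable.mono'
    (((integrable_one_add_norm (μ := (volume : Measure V)) hk).const_mul
      ((1 + 1 / δ) ^ k)).integrableOn)
    (measurable_norm.pow_const (-k)).aestronglyMeasurable ?_
  refine (ae_restrict_mem measurableSet_ball.compl).mono fun z hz => ?_
  have hz' : δ ≤ ‖z‖ := by simpa using hz
  have hz0 : 0 < ‖z‖ := hδ.trans_le hz'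
  rw [Real.norm_of_nonneg (by positivity), Real.rpow_neg (by positivity),
    Real.rpow_neg (by positivity), ← div_eq_mul_inv, inv_eq_one_div,
    div_le_div_iff₀ (by positivity) (by positivity), one_mul,
    ← Real.mul_rpow (by positivity) (by positivity)]
  refine Real.rpow_le_rpow (by positivity) ?_ hk0.le
  have : 1 ≤ 1 / δ * ‖z‖ := by rw [one_div, ← div_eq_inv_mul]; exact (one_le_div hδ).2 hz'
  linarith

end Slab

/-! ### Signs and their symmetric sums. -/

/-- The sign of a real number, with value `-1` at zero. -/
noncomputable def posSign (t : ℝ) : ℝ := if 0 < t then 1 else -1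

theorem posSign_of_pos {t : ℝ} (ht : 0 < t) : posSign t = 1 := if_pos ht

theorem posSign_of_nonpos {t : ℝ} (ht : t ≤ 0) : posSign t = -1 := if_neg ht.not_gt

theorem neg_one_le_posSign (t : ℝ) : -1 ≤ posSign t := by
  unfold posSign; split_ifs <;> norm_num

theorem posSign_le_one (t : ℝ) : posSign t ≤ 1 := by
  unfold posSign; split_ifs <;> norm_num

theorem measurable_posSign : Measurable posSign :=
  Measurable.ite measurableSet_Ioi measurable_const measurable_const

theorem posSign_congr {s t : ℝ} (h : 0 < s ↔ 0 < t) : posSign s = posSign t := by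
  unfold posSign; simp only [h]

/-- The term `q` dominates, so `d + q` and `d - q` have opposite signs. Strictness keeps both away
from zero, where `posSign` is not odd. -/
theorem posSign_add_posSign_sub_eq_zero {d q : ℝ} (h : |d| < |q|) :
    posSign (d + q) + posSign (d - q) = 0 := by
  have hd := abs_lt.1 h
  rcases le_total 0 q with hq | hq
  · rw [abs_of_nonneg hq] at hd
    rw [posSign_of_pos (by linarith [hd.1]), posSign_of_nonpos (by linarith [hd.2])]; norm_num
  · rw [abs_of_nonpos hq] at hd
    rw [posSign_of_nonpos (by linarith [hd.2]), posSign_of_pos (by linarith [hd.1])]; norm_num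

theorem posSign_add_posSign_sub_nonneg {d : ℝ} (q : ℝ) (hd : 0 < d) :
    0 ≤ posSign (d + q) + posSign (d - q) := by
  rcases le_total 0 q with hq | hq
  · rw [posSign_of_pos (show 0 < d + q by linarith)]
    linarith [neg_one_le_posSign (d - q)]
  · rw [posSign_of_pos (show 0 < d - q by linarith)]
    linarith [neg_one_le_posSign (d + q)]

theorem posSign_add_posSign_sub_nonpos {d : ℝ} (q : ℝ) (hd : d ≤ 0) :
    posSign (d + q) + posSign (d - q) ≤ 0 := by
  rcases le_total 0 q with hq | hq
  · rw [posSign_of_nonpos (show d - q ≤ 0 by linarith)]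
    linarith [posSign_le_one (d + q)]
  · rw [posSign_of_nonpos (show d + q ≤ 0 by linarith)]
    linarith [posSign_le_one (d - q)]

/-! ### The symmetrized sign: its sign pattern and thin support. -/

section SymSign

variable {E F : Type*} [NormedAddCommGroup E] [NormedAddCommGroup F]

/-- The average over the four reflections `(±η, ±ξ)` of the function `χ_A - χ_{Aᶜ}` at
`(a + η, b + ξ)`, where `A = {(u, v) : α |u| < |v|}`. -/
noncomputable def symSign (a : E) (b : F) (α : ℝ) (z : WithLp 2 (E × F)) : ℝ :=
  (posSign (‖b + z.snd‖ - α * ‖a + z.fst‖) + posSign (‖b - z.snd‖ - α * ‖a - z.fst‖) +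
    posSign (‖b + z.snd‖ - α * ‖a - z.fst‖) + posSign (‖b - z.snd‖ - α * ‖a + z.fst‖)) / 4

theorem abs_symSign_le_one (a : E) (b : F) (α : ℝ) (z : WithLp 2 (E × F)) :
    |symSign a b α z| ≤ 1 := by
  unfold symSign
  rw [abs_le]
  constructor
  · linarith [neg_one_le_posSign (‖b + z.snd‖ - α * ‖a + z.fst‖),
      neg_one_le_posSign (‖b - z.snd‖ - α * ‖a - z.fst‖),
      neg_one_le_posSign (‖b + z.snd‖ - α * ‖a - z.fst‖),
      neg_one_le_posSign (‖b - z.snd‖ - α * ‖a + z.fst‖)]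
  · linarith [posSign_le_one (‖b + z.snd‖ - α * ‖a + z.fst‖),
      posSign_le_one (‖b - z.snd‖ - α * ‖a - z.fst‖),
      posSign_le_one (‖b + z.snd‖ - α * ‖a - z.fst‖),
      posSign_le_one (‖b - z.snd‖ - α * ‖a + z.fst‖)]

theorem symSign_eq_one {e : E} {f : F} (he : ‖e‖ = 1) (hf : ‖f‖ = 1) {z : WithLp 2 (E × F)}
    (hz : ‖z.fst‖ + 2 < ‖z.snd‖) : symSign e f 1 z = 1 := by
  have h1 := norm_sub_norm_le z.snd (-f)
  have h2 := norm_sub_norm_le z.snd f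
  have h3 := norm_add_le e z.fst
  have h4 := norm_sub_le e z.fst
  rw [norm_neg, sub_neg_eq_add, add_comm z.snd] at h1
  rw [norm_sub_rev] at h2
  unfold symSign
  rw [posSign_of_pos (by linarith), posSign_of_pos (by linarith),
    posSign_of_pos (by linarith), posSign_of_pos (by linarith)]
  norm_num

theorem symSign_eq_neg_one {e : E} {f : F} (he : ‖e‖ = 1) (hf : ‖f‖ = 1)
    {z : WithLp 2 (E × F)} (hz : ‖z.snd‖ + 2 < ‖z.fst‖) : symSign e f 1 z = -1 := by
  have h1 := norm_sub_norm_le z.fst (-e)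
  have h2 := norm_sub_norm_le z.fst e
  have h3 := norm_add_le f z.snd
  have h4 := norm_sub_le f z.snd
  rw [norm_neg, sub_neg_eq_add, add_comm z.fst] at h1
  rw [norm_sub_rev] at h2
  unfold symSign
  rw [posSign_of_nonpos (by linarith), posSign_of_nonpos (by linarith),
    posSign_of_nonpos (by linarith), posSign_of_nonpos (by linarith)]
  norm_num

theorem posSign_norm_sub_norm (x : F) (y : E) :
    posSign (‖x‖ - 1 * ‖y‖) = posSign (‖x‖ ^ 2 - ‖y‖ ^ 2) := by
  refine posSign_congr ?_
  rw [one_mul, sub_pos, sub_pos, sq_lt_sq₀ (norm_nonneg _) (norm_nonneg _)]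

variable [InnerProductSpace ℝ E] [InnerProductSpace ℝ F]

theorem measurable_symSign [FiniteDimensional ℝ E] [FiniteDimensional ℝ F]
    [MeasurableSpace E] [BorelSpace E] [MeasurableSpace F] [BorelSpace F]
    (a : E) (b : F) (α : ℝ) : Measurable (symSign a b α) := by
  have h : ∀ g : WithLp 2 (E × F) → ℝ, Continuous g → Measurable fun z => posSign (g z) :=
    fun g hg => measurable_posSign.comp hg.measurable
  exact ((((h _ (by fun_prop)).add (h _ (by fun_prop))).add (h _ (by fun_prop))).add
    (h _ (by fun_prop))).div_const 4

/-- After squaring the norms, the constants `‖f‖ ^ 2` and `‖e‖ ^ 2` cancel. Opposite reflections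
then share the even part `d = ‖ξ‖ ^ 2 - ‖η‖ ^ 2` and differ only in the sign of the linear part. -/
theorem symSign_eq {e : E} {f : F} (he : ‖e‖ = 1) (hf : ‖f‖ = 1) (z : WithLp 2 (E × F)) :
    symSign e f 1 z =
      ((posSign (‖z.snd‖ ^ 2 - ‖z.fst‖ ^ 2 + 2 * (inner ℝ f z.snd - inner ℝ e z.fst)) +
        posSign (‖z.snd‖ ^ 2 - ‖z.fst‖ ^ 2 - 2 * (inner ℝ f z.snd - inner ℝ e z.fst))) +
      (posSign (‖z.snd‖ ^ 2 - ‖z.fst‖ ^ 2 + 2 * (inner ℝ f z.snd + inner ℝ e z.fst)) +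
        posSign (‖z.snd‖ ^ 2 - ‖z.fst‖ ^ 2 - 2 * (inner ℝ f z.snd + inner ℝ e z.fst)))) / 4 := by
  unfold symSign
  simp only [posSign_norm_sub_norm, norm_add_sq_real, norm_sub_sq_real, he, hf]
  rw [← add_assoc]
  refine congrArg (· / 4) (congrArg₂ (· + ·) (congrArg₂ (· + ·) (congrArg₂ (· + ·) ?_ ?_) ?_) ?_) <;>
    exact congrArg posSign (by ring)

theorem symSign_nonneg {e : E} {f : F} (he : ‖e‖ = 1) (hf : ‖f‖ = 1) {z : WithLp 2 (E × F)}
    (hz : ‖z.fst‖ < ‖z.snd‖) : 0 ≤ symSign e f 1 z := by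
  have hd : 0 < ‖z.snd‖ ^ 2 - ‖z.fst‖ ^ 2 := by
    have := (sq_lt_sq₀ (norm_nonneg _) (norm_nonneg _)).2 hz
    linarith
  rw [symSign_eq he hf]
  exact div_nonneg (add_nonneg (posSign_add_posSign_sub_nonneg _ hd)
    (posSign_add_posSign_sub_nonneg _ hd)) (by norm_num)

theorem symSign_nonpos {e : E} {f : F} (he : ‖e‖ = 1) (hf : ‖f‖ = 1) {z : WithLp 2 (E × F)}
    (hz : ‖z.snd‖ ≤ ‖z.fst‖) : symSign e f 1 z ≤ 0 := by
  have hd : ‖z.snd‖ ^ 2 - ‖z.fst‖ ^ 2 ≤ 0 := by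
    have := (sq_le_sq₀ (norm_nonneg _) (norm_nonneg _)).2 hz
    linarith
  rw [symSign_eq he hf]
  exact div_nonpos_of_nonpos_of_nonneg (add_nonpos (posSign_add_posSign_sub_nonpos _ hd)
    (posSign_add_posSign_sub_nonpos _ hd)) (by norm_num)

/-- The symmetrized sign vanishes except in two regions around hyperplanes that are
quadratically thin at the origin. -/
theorem abs_inner_le_of_symSign_ne_zero {e : E} {f : F} (he : ‖e‖ = 1) (hf : ‖f‖ = 1)
    {z : WithLp 2 (E × F)} (hz : symSign e f 1 z ≠ 0) :
    |inner ℝ f z.snd - inner ℝ e z.fst| ≤ ‖z‖ ^ 2 / 2 ∨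
      |inner ℝ f z.snd + inner ℝ e z.fst| ≤ ‖z‖ ^ 2 / 2 := by
  contrapose! hz
  have hd : |‖z.snd‖ ^ 2 - ‖z.fst‖ ^ 2| ≤ ‖z‖ ^ 2 := by
    rw [WithLp.prod_norm_sq_eq_of_L2, abs_le]
    constructor <;> nlinarith [sq_nonneg ‖z.snd‖, sq_nonneg ‖z.fst‖]
  rw [symSign_eq he hf, posSign_add_posSign_sub_eq_zero, posSign_add_posSign_sub_eq_zero]
  · norm_num
  · rw [abs_mul, abs_two]; linarith [hz.2]
  · rw [abs_mul, abs_two]; linarith [hz.1]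

variable [FiniteDimensional ℝ E] [FiniteDimensional ℝ F]
    [MeasurableSpace E] [BorelSpace E] [MeasurableSpace F] [BorelSpace F]

/-- The support inside the ball of radius `r` lies in two slabs normal to `(-e, f)` and `(e, f)`,
with `ε = r ^ 2 / 2`. The slab estimate bounds each volume by a multiple of `r⁻¹ * r ^ 2 * (2 * r) ^
N`. -/
theorem exists_volume_ball_inter_support_symSign_le {e : E} {f : F} (he : ‖e‖ = 1)
    (hf : ‖f‖ = 1) : ∃ C : ℝ, ∀ r : ℝ, 0 < r →
      volume (Metric.ball (0 : WithLp 2 (E × F)) r ∩ Function.support (symSign e f 1)) ≤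
        ENNReal.ofReal (C * r ^ ((Module.finrank ℝ (WithLp 2 (E × F)) : ℝ) + 1)) := by
  set N := Module.finrank ℝ (WithLp 2 (E × F)) with hN
  obtain ⟨B, hB0, hB⟩ : ∃ B : ℝ, 0 ≤ B ∧
      volume (Metric.ball (0 : WithLp 2 (E × F)) 1) = ENNReal.ofReal B :=
    ⟨_, ENNReal.toReal_nonneg, (ENNReal.ofReal_toReal measure_ball_lt_top.ne).symm⟩
  have key : ∀ (w : WithLp 2 (E × F)), inner ℝ w (WithLp.toLp 2 ((0 : E), f)) = 1 →
      ∀ r : ℝ, 0 < r → volume {z : WithLp 2 (E × F) | ‖z‖ < r ∧ |inner ℝ w z| ≤ r ^ 2 / 2} ≤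
        ENNReal.ofReal (2 ^ N * B * r ^ ((N : ℝ) + 1)) := by
    intro w hw r hr
    have h := mul_volume_slab_le hw r (r ^ 2 / 2)
    rw [show ‖(WithLp.toLp 2 ((0 : E), f) : WithLp 2 (E × F))‖ = 1 by simpa using hf,
      Measure.addHaar_ball_of_pos _ _ (by positivity), hB,
      ← ENNReal.ofReal_mul (by positivity), ← ENNReal.ofReal_mul (by positivity)] at h
    rw [← ENNReal.mul_le_mul_iff_right (a := ENNReal.ofReal r)
      (by simpa using hr) ENNReal.ofReal_ne_top, ← ENNReal.ofReal_mul hr.le]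
    refine h.trans (le_of_eq ?_)
    congr 1
    rw [Real.rpow_add_one hr.ne', Real.rpow_natCast, mul_pow, ← hN]
    ring
  refine ⟨2 * (2 ^ N * B), fun r hr => ?_⟩
  have hsub : Metric.ball (0 : WithLp 2 (E × F)) r ∩ Function.support (symSign e f 1) ⊆
      {z | ‖z‖ < r ∧ |inner ℝ (WithLp.toLp 2 (-e, f) : WithLp 2 (E × F)) z| ≤ r ^ 2 / 2} ∪
      {z | ‖z‖ < r ∧ |inner ℝ (WithLp.toLp 2 (e, f) : WithLp 2 (E × F)) z| ≤ r ^ 2 / 2} := by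
    rintro z ⟨hz, hz'⟩
    have hzr : ‖z‖ < r := by simpa using hz
    have hz2 : ‖z‖ ^ 2 / 2 ≤ r ^ 2 / 2 := by gcongr
    refine (abs_inner_le_of_symSign_ne_zero he hf hz').imp (fun h => ⟨hzr, ?_⟩)
      (fun h => ⟨hzr, ?_⟩)
    · refine le_trans (le_of_eq ?_) (h.trans hz2)
      rw [WithLp.prod_inner_apply]
      simp [inner_neg_left]; ring_nf
    · refine le_trans (le_of_eq ?_) (h.trans hz2)
      rw [WithLp.prod_inner_apply]
      simp; ring_nf
  refine (measure_mono hsub).trans ((measure_union_le _ _).trans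
    ((add_le_add (key _ (by simp [WithLp.prod_inner_apply, hf]) r hr)
      (key _ (by simp [WithLp.prod_inner_apply, hf]) r hr)).trans (le_of_eq ?_)))
  rw [← ENNReal.ofReal_add (by positivity) (by positivity)]
  congr 1
  ring

theorem integrable_symSign_mul_norm_rpow {e : E} {f : F} (he : ‖e‖ = 1) (hf : ‖f‖ = 1) {k : ℝ}
    (hk : (Module.finrank ℝ (WithLp 2 (E × F)) : ℝ) < k)
    (hk' : k < (Module.finrank ℝ (WithLp 2 (E × F)) : ℝ) + 1) :
    Integrable fun z : WithLp 2 (E × F) => symSign e f 1 z * ‖z‖ ^ (-k) := by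
  obtain ⟨C, hC⟩ := exists_volume_ball_inter_support_symSign_le (E := E) (F := F) he hf
  have hm := measurable_symSign e f 1
  have hpow : Measurable fun z : WithLp 2 (E × F) => ‖z‖ ^ (-k) := measurable_norm.pow_const (-k)
  have hsupp : MeasurableSet (Function.support (symSign e f 1)) := measurableSet_support hm
  have h1 : IntegrableOn (fun z : WithLp 2 (E × F) => ‖z‖ ^ (-k))
      (Function.support (symSign e f 1)) := by
    refine ⟨hpow.aestronglyMeasurable, ?_⟩
    rw [hasFiniteIntegral_iff_ofReal (Eventually.of_forall fun z => by positivity)]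
    exact setLIntegral_norm_rpow_lt_top hC hk hk'
  refine ((integrable_indicator_iff hsupp).2 h1).mono' (hm.mul hpow).aestronglyMeasurable
    (Eventually.of_forall fun z => ?_)
  by_cases hz : z ∈ Function.support (symSign e f 1)
  · rw [indicator_of_mem hz, norm_mul, Real.norm_of_nonneg (by positivity : 0 ≤ ‖z‖ ^ (-k))]
    exact mul_le_of_le_one_left (by positivity) (abs_symSign_le_one _ _ _ _)
  · rw [indicator_of_notMem hz, Function.notMem_support.1 hz]
    simp

end SymSign

/-! ### The anisotropic kernel and its monotonicity in the slope. -/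

section ConeKernel

variable {E F : Type*} [NormedAddCommGroup E] [NormedAddCommGroup F]

/-- The anisotropic kernel of homogeneity `-k`, normalized to be independent of `α` on the cone
`‖ξ‖ = ‖η‖`. -/
noncomputable def coneKernel (k α : ℝ) (z : WithLp 2 (E × F)) : ℝ :=
  ((‖z.fst‖ ^ 2 + α ^ 2 * ‖z.snd‖ ^ 2) / (1 + α ^ 2)) ^ (-(k / 2))

theorem coneKernel_nonneg (k α : ℝ) (z : WithLp 2 (E × F)) : 0 ≤ coneKernel k α z := by
  unfold coneKernel; positivity

theorem fst_ne_zero_or_snd_ne_zero {z : WithLp 2 (E × F)} (hz : z ≠ 0) :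
    z.fst ≠ 0 ∨ z.snd ≠ 0 := by
  contrapose! hz
  have := WithLp.prod_norm_sq_eq_of_L2 z
  rw [hz.1, hz.2] at this
  simpa using this

theorem quadratic_pos {α : ℝ} (hα : 0 < α) {z : WithLp 2 (E × F)} (hz : z ≠ 0) :
    0 < ‖z.fst‖ ^ 2 + α ^ 2 * ‖z.snd‖ ^ 2 := by
  rcases fst_ne_zero_or_snd_ne_zero hz with h | h
  · have := norm_pos_iff.2 h; positivity
  · have := norm_pos_iff.2 h; positivity

theorem coneKernel_zero (k α β : ℝ) :
    coneKernel k α (0 : WithLp 2 (E × F)) = coneKernel k β (0 : WithLp 2 (E × F)) := by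
  simp [coneKernel]

/-- The base of the power is a weighted mean of `‖η‖ ^ 2` and `‖ξ‖ ^ 2` with weights `1 : α ^ 2`.
Raising `α` moves it towards `‖ξ‖ ^ 2`, here the larger one, and the exponent is negative. -/
theorem coneKernel_lt {k α β : ℝ} (hk : 0 < k) (hα : 0 < α) (hαβ : α < β)
    {z : WithLp 2 (E × F)} (hz : ‖z.fst‖ < ‖z.snd‖) : coneKernel k β z < coneKernel k α z := by
  have hz0 : z ≠ 0 := by rintro rfl; simp at hz
  have h1 := quadratic_pos hα hz0
  refine Real.rpow_lt_rpow_of_neg (by positivity) ?_ (by linarith)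
  rw [div_lt_div_iff₀ (by positivity) (by positivity)]
  have h2 : ‖z.fst‖ ^ 2 < ‖z.snd‖ ^ 2 := (sq_lt_sq₀ (norm_nonneg _) (norm_nonneg _)).2 hz
  have h3 : α ^ 2 < β ^ 2 := (sq_lt_sq₀ hα.le (hα.trans hαβ).le).2 hαβ
  nlinarith [mul_pos (sub_pos.2 h2) (sub_pos.2 h3)]

theorem coneKernel_anti {k α β : ℝ} (hk : 0 < k) (hα : 0 < α) (hαβ : α ≤ β)
    {z : WithLp 2 (E × F)} (hz : ‖z.fst‖ < ‖z.snd‖) : coneKernel k β z ≤ coneKernel k α z := by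
  rcases hαβ.eq_or_lt with rfl | h
  · exact le_rfl
  · exact (coneKernel_lt hk hα h hz).le

theorem coneKernel_mono {k α β : ℝ} (hk : 0 < k) (hα : 0 < α) (hαβ : α ≤ β)
    {z : WithLp 2 (E × F)} (hz : ‖z.snd‖ ≤ ‖z.fst‖) : coneKernel k α z ≤ coneKernel k β z := by
  by_cases hz0 : z = 0
  · rw [hz0, coneKernel_zero k α β]
  have h1 := quadratic_pos (hα.trans_le hαβ) hz0
  refine Real.rpow_le_rpow_of_nonpos (by positivity) ?_ (by linarith)
  rw [div_le_div_iff₀ (by positivity) (by positivity)]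
  have h2 : ‖z.snd‖ ^ 2 ≤ ‖z.fst‖ ^ 2 := (sq_le_sq₀ (norm_nonneg _) (norm_nonneg _)).2 hz
  have h3 : α ^ 2 ≤ β ^ 2 := (sq_le_sq₀ hα.le (hα.le.trans hαβ)).2 hαβ
  nlinarith [mul_nonneg (sub_nonneg.2 h2) (sub_nonneg.2 h3)]

theorem coneKernel_le_norm_rpow {k α : ℝ} (hk : 0 < k) (hα : 0 < α) (z : WithLp 2 (E × F)) :
    coneKernel k α z ≤ (min 1 (α ^ 2) / (1 + α ^ 2)) ^ (-(k / 2)) * ‖z‖ ^ (-k) := by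
  by_cases hz0 : z = 0
  · rw [hz0]
    simp only [coneKernel, WithLp.zero_fst, WithLp.zero_snd, norm_zero]
    -- At the origin both sides are zero, by the convention `0 ^ x = 0` for `x ≠ 0`.
    rw [Real.zero_rpow (by linarith)]
    simp only [ne_eq, OfNat.ofNat_ne_zero, not_false_eq_true, zero_pow, mul_zero, add_zero,
      zero_div]
    rw [Real.zero_rpow (by linarith)]
  have hc : 0 < min 1 (α ^ 2) := lt_min one_pos (by positivity)
  have hz : 0 < ‖z‖ := norm_pos_iff.2 hz0
  have hpow : ‖z‖ ^ (-k) = (‖z‖ ^ 2) ^ (-(k / 2)) := by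
    rw [← Real.rpow_natCast, ← Real.rpow_mul hz.le]
    congr 1; push_cast; ring
  rw [hpow, ← Real.mul_rpow (by positivity) (by positivity)]
  refine Real.rpow_le_rpow_of_nonpos (by positivity) ?_ (by linarith)
  rw [div_mul_eq_mul_div]
  refine div_le_div_of_nonneg_right ?_ (by positivity)
  rw [WithLp.prod_norm_sq_eq_of_L2]
  nlinarith [mul_le_mul_of_nonneg_right (min_le_left 1 (α ^ 2)) (sq_nonneg ‖z.fst‖),
    mul_le_mul_of_nonneg_right (min_le_right 1 (α ^ 2)) (sq_nonneg ‖z.snd‖)]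

theorem continuousAt_coneKernel {k α : ℝ} (hα : 0 < α) (z : WithLp 2 (E × F)) :
    ContinuousAt (fun β => coneKernel k β z) α := by
  by_cases hz0 : z = 0
  · rw [hz0]
    simp only [fun β => coneKernel_zero (E := E) (F := F) k β α]
    exact continuousAt_const
  have h := quadratic_pos hα hz0
  refine ContinuousAt.rpow_const ?_ (Or.inl (by positivity))
  exact ContinuousAt.div (by fun_prop) (by fun_prop) (by positivity)

theorem le_coneKernel_of_le {k α q : ℝ} (hk : 0 < k) (hα : 0 < α) {z : WithLp 2 (E × F)}
    (hz : z ≠ 0) (hq : ‖z.fst‖ ^ 2 + α ^ 2 * ‖z.snd‖ ^ 2 ≤ q * (1 + α ^ 2)) :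
    q ^ (-(k / 2)) ≤ coneKernel k α z := by
  have h := quadratic_pos hα hz
  exact Real.rpow_le_rpow_of_nonpos (by positivity) ((div_le_iff₀ (by positivity)).2 hq)
    (by linarith)

theorem measurable_coneKernel [MeasurableSpace E] [BorelSpace E] [MeasurableSpace F] [BorelSpace F]
    [SecondCountableTopologyEither E F] (k α : ℝ) :
    Measurable (coneKernel k α : WithLp 2 (E × F) → ℝ) := by
  have h : Continuous fun z : WithLp 2 (E × F) =>
    (‖z.fst‖ ^ 2 + α ^ 2 * ‖z.snd‖ ^ 2) / (1 + α ^ 2) := by fun_prop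
  exact h.measurable.pow_const _

end ConeKernel

/-- The right side is a constant times `ε ^ (m - k)`, which blows up. It serves as kernel size times
volume of a thin region; `26 = 1 + 5 ^ 2` comes from a ball of radius `ε` in one factor and a shell
of outer radius `5` in the other. -/
theorem exists_lt_mul_rpow_mul_pow {c : ℝ} (hc : 0 < c) (A : ℝ) {k : ℝ} {m : ℕ} (hm : (m : ℝ) < k) :
    ∃ ε : ℝ, 0 < ε ∧ ε ≤ 1 ∧ A < (26 * ε ^ 2) ^ (-(k / 2)) * (ε ^ m * c) := by
  have h26 : (0 : ℝ) < 26 ^ (-(k / 2)) := by positivity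
  have ht : Tendsto (fun ε : ℝ => 26 ^ (-(k / 2)) * c * ε ^ (-(k - m))) (𝓝[>] 0) atTop :=
    (tendsto_rpow_neg_nhdsGT_zero (by linarith)).const_mul_atTop (mul_pos h26 hc)
  obtain ⟨ε, hε, hε0, hε1⟩ := ((ht.eventually_gt_atTop A).and
    (Ioc_mem_nhdsGT (zero_lt_one' ℝ))).exists
  refine ⟨ε, hε0, hε1, hε.trans_eq ?_⟩
  rw [Real.mul_rpow (by norm_num) (by positivity), ← Real.rpow_natCast ε 2,
    ← Real.rpow_mul hε0.le, neg_sub, sub_eq_add_neg, Real.rpow_add hε0, Real.rpow_natCast]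
  rw [show ((2 : ℕ) : ℝ) * -(k / 2) = -k by push_cast; ring]
  ring

/-! ### The profile: strict monotonicity, continuity and change of sign. -/

section Profile

theorem isOpen_shell (E : Type*) [NormedAddCommGroup E] : IsOpen {x : E | 4 < ‖x‖ ∧ ‖x‖ < 5} :=
  (isOpen_lt continuous_const continuous_norm).and (isOpen_lt continuous_norm continuous_const)

variable {E F : Type*} [NormedAddCommGroup E] [InnerProductSpace ℝ E]
  [NormedAddCommGroup F] [InnerProductSpace ℝ F]

theorem symSign_mul_coneKernel_anti {e : E} {f : F} (he : ‖e‖ = 1) (hf : ‖f‖ = 1) {k α β : ℝ}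
    (hk : 0 < k) (hα : 0 < α) (hαβ : α ≤ β) (z : WithLp 2 (E × F)) :
    symSign e f 1 z * coneKernel k β z ≤ symSign e f 1 z * coneKernel k α z := by
  rcases lt_or_ge ‖z.fst‖ ‖z.snd‖ with h | h
  · exact mul_le_mul_of_nonneg_left (coneKernel_anti hk hα hαβ h) (symSign_nonneg he hf h)
  · exact mul_le_mul_of_nonpos_left (coneKernel_mono hk hα hαβ h) (symSign_nonpos he hf h)

variable [FiniteDimensional ℝ E] [FiniteDimensional ℝ F]

theorem finrank_withLp_prod :
    Module.finrank ℝ (WithLp 2 (E × F)) = Module.finrank ℝ E + Module.finrank ℝ F := by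
  rw [(WithLp.linearEquiv 2 ℝ (E × F)).finrank_eq, Module.finrank_prod]

variable [MeasurableSpace E] [BorelSpace E] [MeasurableSpace F] [BorelSpace F]

theorem integrable_symSign_mul_coneKernel {e : E} {f : F} (he : ‖e‖ = 1) (hf : ‖f‖ = 1) {k α : ℝ}
    (hk : (Module.finrank ℝ (WithLp 2 (E × F)) : ℝ) < k)
    (hk' : k < (Module.finrank ℝ (WithLp 2 (E × F)) : ℝ) + 1) (hα : 0 < α) :
    Integrable fun z : WithLp 2 (E × F) => symSign e f 1 z * coneKernel k α z := by
  have hk0 : 0 < k := lt_of_le_of_lt (Nat.cast_nonneg _) hk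
  refine ((integrable_symSign_mul_norm_rpow he hf hk hk').norm.const_mul
    ((min 1 (α ^ 2) / (1 + α ^ 2)) ^ (-(k / 2)))).mono'
    ((measurable_symSign e f 1).mul (measurable_coneKernel k α)).aestronglyMeasurable
    (Eventually.of_forall fun z => ?_)
  rw [norm_mul, norm_mul, Real.norm_of_nonneg (coneKernel_nonneg _ _ _),
    Real.norm_of_nonneg (by positivity : 0 ≤ ‖z‖ ^ (-k)), mul_left_comm]
  exact mul_le_mul_of_nonneg_left (coneKernel_le_norm_rpow hk0 hα z) (norm_nonneg _)

/-- Up to a positive factor, the fractional mean curvature of the cone `‖v‖ = α ‖u‖`. -/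
noncomputable def coneProfile (e : E) (f : F) (k α : ℝ) : ℝ :=
  ∫ z : WithLp 2 (E × F), symSign e f 1 z * coneKernel k α z

theorem strictAntiOn_coneProfile {e : E} {f : F} (he : ‖e‖ = 1) (hf : ‖f‖ = 1) {k : ℝ}
    (hk : (Module.finrank ℝ (WithLp 2 (E × F)) : ℝ) < k)
    (hk' : k < (Module.finrank ℝ (WithLp 2 (E × F)) : ℝ) + 1) :
    StrictAntiOn (coneProfile e f k) (Ioi 0) := by
  intro α hα β hβ hαβ
  have hk0 : 0 < k := lt_of_le_of_lt (Nat.cast_nonneg _) hk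
  have iα := integrable_symSign_mul_coneKernel he hf hk hk' hα
  have iβ := integrable_symSign_mul_coneKernel he hf hk hk' hβ
  rw [← sub_pos, coneProfile, coneProfile, ← integral_sub iα iβ,
    integral_pos_iff_support_of_nonneg
      (fun z => sub_nonneg.2 (symSign_mul_coneKernel_anti he hf hk0 hα hαβ.le z)) (iα.sub iβ)]
  have hopen : IsOpen {z : WithLp 2 (E × F) | ‖z.fst‖ + 2 < ‖z.snd‖} :=
    isOpen_lt (by fun_prop) (by fun_prop)
  refine (hopen.measure_pos volume ⟨WithLp.toLp 2 (0, (3 : ℝ) • f), ?_⟩).trans_le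
    (measure_mono fun z hz => ?_)
  · simp [norm_smul, hf]; norm_num
  · have hz' : ‖z.fst‖ + 2 < ‖z.snd‖ := hz
    rw [Function.mem_support, symSign_eq_one he hf hz', one_mul, one_mul]
    exact (sub_pos.2 (coneKernel_lt hk0 hα hαβ (by linarith))).ne'

theorem continuousOn_coneProfile {e : E} {f : F} (he : ‖e‖ = 1) (hf : ‖f‖ = 1) {k : ℝ}
    (hk : (Module.finrank ℝ (WithLp 2 (E × F)) : ℝ) < k)
    (hk' : k < (Module.finrank ℝ (WithLp 2 (E × F)) : ℝ) + 1) :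
    ContinuousOn (coneProfile e f k) (Ioi 0) := by
  intro α hα
  have hα0 : 0 < α := hα
  have hk0 : 0 < k := lt_of_le_of_lt (Nat.cast_nonneg _) hk
  refine ContinuousAt.continuousWithinAt ?_
  -- For each `z` the kernel is monotone in the slope, in a direction depending on `z`. The sum of
  -- its values at `α / 2` and `2 * α` therefore dominates in between.
  refine continuousAt_of_dominated
    (bound := fun z => ‖symSign e f 1 z * coneKernel k (α / 2) z‖ +
      ‖symSign e f 1 z * coneKernel k (2 * α) z‖)
    (Eventually.of_forall fun β =>
      ((measurable_symSign e f 1).mul (measurable_coneKernel k β)).aestronglyMeasurable) ?_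
    ((integrable_symSign_mul_coneKernel he hf hk hk' (by positivity)).norm.add
      (integrable_symSign_mul_coneKernel he hf hk hk' (by positivity)).norm)
    (Eventually.of_forall fun z => continuousAt_const.mul (continuousAt_coneKernel hα0 z))
  filter_upwards [Ioo_mem_nhds (show α / 2 < α by linarith) (show α < 2 * α by linarith)]
    with β hβ
  refine Eventually.of_forall fun z => ?_
  rw [norm_mul, norm_mul, norm_mul, ← mul_add]
  refine mul_le_mul_of_nonneg_left ?_ (norm_nonneg _)
  simp only [Real.norm_of_nonneg (coneKernel_nonneg _ _ z)]
  have hβ0 : 0 < β := (by positivity : 0 < α / 2).trans hβ.1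
  rcases lt_or_ge ‖z.fst‖ ‖z.snd‖ with h | h
  · exact (coneKernel_anti hk0 (by positivity) hβ.1.le h).trans
      (le_add_of_nonneg_right (coneKernel_nonneg _ _ _))
  · exact (coneKernel_mono hk0 hβ0 hβ.2.le h).trans
      (le_add_of_nonneg_left (coneKernel_nonneg _ _ _))

theorem volume_setOf_fst_mem_and_snd_mem {s : Set E} {t : Set F} (hs : MeasurableSet s)
    (ht : MeasurableSet t) :
    volume {z : WithLp 2 (E × F) | z.fst ∈ s ∧ z.snd ∈ t} = volume s * volume t := by
  rw [← Measure.prod_prod s t, ← Measure.volume_eq_prod,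
    ← (WithLp.volume_preserving_ofLp E F).measure_preimage (hs.prod ht).nullMeasurableSet]
  rfl

/-- The spherical shell used to bound the curvature of very flat and very steep cones. -/
theorem exists_volume_shell_eq {E : Type*} [NormedAddCommGroup E] [InnerProductSpace ℝ E]
    [FiniteDimensional ℝ E] [MeasurableSpace E] [BorelSpace E] {e : E} (he : ‖e‖ = 1) :
    ∃ c : ℝ, 0 < c ∧ volume {x : E | 4 < ‖x‖ ∧ ‖x‖ < 5} = ENNReal.ofReal c := by
  have hpos := (isOpen_shell E).measure_pos volume ⟨(9 / 2 : ℝ) • e, by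
    simp only [mem_ofPred_eq, norm_smul, he]; norm_num⟩
  have hfin : volume {x : E | 4 < ‖x‖ ∧ ‖x‖ < 5} ≠ ⊤ :=
    ((measure_mono fun x hx => mem_ball_zero_iff.2 hx.2).trans_lt
      (measure_ball_lt_top (x := (0 : E)) (r := 5))).ne
  exact ⟨_, ENNReal.toReal_pos hpos.ne' hfin, (ENNReal.ofReal_toReal hfin).symm⟩

theorem exists_volume_ball_eq (E : Type*) [NormedAddCommGroup E] [InnerProductSpace ℝ E]
    [FiniteDimensional ℝ E] [MeasurableSpace E] [BorelSpace E] :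
    ∃ c : ℝ, 0 < c ∧ ∀ r : ℝ, 0 < r →
      volume (Metric.ball (0 : E) r) = ENNReal.ofReal (r ^ Module.finrank ℝ E * c) := by
  have hfin : volume (Metric.ball (0 : E) 1) ≠ ⊤ := measure_ball_lt_top.ne
  refine ⟨_, ENNReal.toReal_pos (Metric.measure_ball_pos volume 0 one_pos).ne' hfin,
    fun r hr => ?_⟩
  rw [Measure.addHaar_ball_of_pos _ _ hr, ENNReal.ofReal_mul (by positivity),
    ENNReal.ofReal_toReal hfin]

theorem exists_coneProfile_pos {e : E} {f : F} (he : ‖e‖ = 1) (hf : ‖f‖ = 1) {k : ℝ}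
    (hk : (Module.finrank ℝ (WithLp 2 (E × F)) : ℝ) < k)
    (hk' : k < (Module.finrank ℝ (WithLp 2 (E × F)) : ℝ) + 1) :
    ∃ α : ℝ, 0 < α ∧ α ≤ 1 ∧ 0 < coneProfile e f k α := by
  have hk0 : 0 < k := lt_of_le_of_lt (Nat.cast_nonneg _) hk
  obtain ⟨c₁, hc₁, hball⟩ := exists_volume_ball_eq E
  obtain ⟨c₂, hc₂, hshell⟩ := exists_volume_shell_eq hf
  have i1 := (integrable_symSign_mul_coneKernel he hf hk hk' one_pos).norm
  obtain ⟨α, hα0, hα1, hα⟩ := exists_lt_mul_rpow_mul_pow (mul_pos hc₁ hc₂)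
    (∫ z : WithLp 2 (E × F), ‖symSign e f 1 z * coneKernel k 1 z‖)
    (k := k) (m := Module.finrank ℝ E) (by
      rw [finrank_withLp_prod] at hk; push_cast at hk
      linarith [(Nat.cast_nonneg (Module.finrank ℝ F) : (0 : ℝ) ≤ _)])
  refine ⟨α, hα0, hα1, ?_⟩
  set B : Set (WithLp 2 (E × F)) :=
    {z | z.fst ∈ Metric.ball 0 α ∧ z.snd ∈ {x : F | 4 < ‖x‖ ∧ ‖x‖ < 5}} with hB
  have hshm := (isOpen_shell F).measurableSet
  have hBm : MeasurableSet B :=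
    (measurableSet_ball.prod hshm).preimage (WithLp.volume_preserving_ofLp E F).measurable
  have hBv : volume B = ENNReal.ofReal (α ^ Module.finrank ℝ E * (c₁ * c₂)) := by
    rw [hB, volume_setOf_fst_mem_and_snd_mem measurableSet_ball hshm, hball α hα0, hshell,
      ← ENNReal.ofReal_mul (by positivity), mul_assoc]
  have iB : Integrable (B.indicator fun _ => (26 * α ^ 2) ^ (-(k / 2))) :=
    (integrable_indicator_iff hBm).2 (integrableOn_const (by rw [hBv]; simp))
  -- On `B` the sign is `1` and the kernel is large. Elsewhere, as `α ≤ 1`, the integrand is at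
  -- least its value at slope `1`, whose total mass is fixed.
  have hle : ∫ z, (B.indicator (fun _ => (26 * α ^ 2) ^ (-(k / 2))) z -
      ‖symSign e f 1 z * coneKernel k 1 z‖) ≤ coneProfile e f k α := by
    refine integral_mono (iB.sub i1) (integrable_symSign_mul_coneKernel he hf hk hk' hα0)
      fun z => ?_
    simp only
    by_cases hz : z ∈ B
    · have h1 : ‖z.fst‖ < α := mem_ball_zero_iff.1 hz.1
      have h2 : 4 < ‖z.snd‖ ∧ ‖z.snd‖ < 5 := hz.2
      rw [indicator_of_mem hz, symSign_eq_one he hf (z := z) (by linarith), one_mul, one_mul]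
      refine (sub_le_self _ (norm_nonneg _)).trans (le_coneKernel_of_le hk0 hα0 ?_ ?_)
      · rintro rfl
        have := h2.1
        simp at this
        linarith
      · have h3 : ‖z.fst‖ ^ 2 ≤ α ^ 2 := by gcongr
        have h4 : ‖z.snd‖ ^ 2 ≤ 5 ^ 2 := by gcongr; exact h2.2.le
        nlinarith [mul_le_mul_of_nonneg_left h4 (sq_nonneg α), sq_nonneg (α ^ 2)]
    · rw [indicator_of_notMem hz, zero_sub]
      refine (neg_abs_le _).trans (symSign_mul_coneKernel_anti he hf hk0 hα0 hα1 z)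
  rw [integral_sub iB i1, integral_indicator hBm, setIntegral_const, measureReal_def, hBv,
    ENNReal.toReal_ofReal (by positivity), smul_eq_mul] at hle
  linarith

theorem exists_coneProfile_neg {e : E} {f : F} (he : ‖e‖ = 1) (hf : ‖f‖ = 1) {k : ℝ}
    (hk : (Module.finrank ℝ (WithLp 2 (E × F)) : ℝ) < k)
    (hk' : k < (Module.finrank ℝ (WithLp 2 (E × F)) : ℝ) + 1) :
    ∃ α : ℝ, 1 ≤ α ∧ coneProfile e f k α < 0 := by
  have hk0 : 0 < k := lt_of_le_of_lt (Nat.cast_nonneg _) hk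
  obtain ⟨c₁, hc₁, hball⟩ := exists_volume_ball_eq F
  obtain ⟨c₂, hc₂, hshell⟩ := exists_volume_shell_eq he
  have i1 := (integrable_symSign_mul_coneKernel he hf hk hk' one_pos).norm
  obtain ⟨ε, hε0, hε1, hε⟩ := exists_lt_mul_rpow_mul_pow (mul_pos hc₁ hc₂)
    (∫ z : WithLp 2 (E × F), ‖symSign e f 1 z * coneKernel k 1 z‖)
    (k := k) (m := Module.finrank ℝ F) (by
      rw [finrank_withLp_prod] at hk; push_cast at hk
      linarith [(Nat.cast_nonneg (Module.finrank ℝ E) : (0 : ℝ) ≤ _)])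
  have hα1 : 1 ≤ ε⁻¹ := (one_le_inv₀ hε0).2 hε1
  have hα0 : 0 < ε⁻¹ := by positivity
  refine ⟨ε⁻¹, hα1, ?_⟩
  set B : Set (WithLp 2 (E × F)) :=
    {z | z.fst ∈ {x : E | 4 < ‖x‖ ∧ ‖x‖ < 5} ∧ z.snd ∈ Metric.ball 0 ε} with hB
  have hshm := (isOpen_shell E).measurableSet
  have hBm : MeasurableSet B :=
    (hshm.prod measurableSet_ball).preimage (WithLp.volume_preserving_ofLp E F).measurable
  have hBv : volume B = ENNReal.ofReal (ε ^ Module.finrank ℝ F * (c₁ * c₂)) := by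
    rw [hB, volume_setOf_fst_mem_and_snd_mem hshm measurableSet_ball, hball ε hε0, hshell,
      ← ENNReal.ofReal_mul (by positivity)]
    congr 1; ring
  have iB : Integrable (B.indicator fun _ => (26 * ε ^ 2) ^ (-(k / 2))) :=
    (integrable_indicator_iff hBm).2 (integrableOn_const (by rw [hBv]; simp))
  have hle : coneProfile e f k ε⁻¹ ≤ ∫ z, (‖symSign e f 1 z * coneKernel k 1 z‖ -
      B.indicator (fun _ => (26 * ε ^ 2) ^ (-(k / 2))) z) := by
    refine integral_mono (integrable_symSign_mul_coneKernel he hf hk hk' hα0) (i1.sub iB)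
      fun z => ?_
    simp only
    by_cases hz : z ∈ B
    · have h1 : ‖z.snd‖ < ε := mem_ball_zero_iff.1 hz.2
      have h2 : 4 < ‖z.fst‖ ∧ ‖z.fst‖ < 5 := hz.1
      rw [indicator_of_mem hz, symSign_eq_neg_one he hf (by linarith)]
      -- With slope `ε⁻¹` the numerator of the base is at most `25 + 1`, while `26 * ε ^ 2 * (1 +
      -- ε⁻¹ ^ 2) = 26 * ε ^ 2 + 26`.
      have h5 : (26 * ε ^ 2) ^ (-(k / 2)) ≤ coneKernel k ε⁻¹ z := by
        refine le_coneKernel_of_le hk0 hα0 ?_ ?_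
        · rintro rfl
          have := h2.1
          simp at this
          linarith
        · have h3 : ‖z.snd‖ ^ 2 ≤ ε ^ 2 := by gcongr
          have h4 : ‖z.fst‖ ^ 2 ≤ 5 ^ 2 := by gcongr; exact h2.2.le
          have h6 : (ε⁻¹) ^ 2 * ε ^ 2 = 1 := by field_simp
          nlinarith [mul_le_mul_of_nonneg_left h3 (sq_nonneg ε⁻¹), sq_nonneg ε]
      linarith [norm_nonneg (-1 * coneKernel k 1 z)]
    · rw [indicator_of_notMem hz, sub_zero]
      exact (symSign_mul_coneKernel_anti he hf hk0 one_pos hα1 z).trans (Real.le_norm_self _)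
  rw [integral_sub i1 iB, integral_indicator hBm, setIntegral_const, measureReal_def, hBv,
    ENNReal.toReal_ofReal (by positivity), smul_eq_mul] at hle
  linarith

theorem existsUnique_coneProfile_eq_zero {e : E} {f : F} (he : ‖e‖ = 1) (hf : ‖f‖ = 1) {k : ℝ}
    (hk : (Module.finrank ℝ (WithLp 2 (E × F)) : ℝ) < k)
    (hk' : k < (Module.finrank ℝ (WithLp 2 (E × F)) : ℝ) + 1) :
    ∃! α : ℝ, 0 < α ∧ coneProfile e f k α = 0 := by
  obtain ⟨α, hα0, hα1, hα⟩ := exists_coneProfile_pos he hf hk hk'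
  obtain ⟨β, hβ1, hβ⟩ := exists_coneProfile_neg he hf hk hk'
  obtain ⟨γ, hγ, hγ0⟩ := intermediate_value_Icc' (hα1.trans hβ1)
    ((continuousOn_coneProfile he hf hk hk').mono fun x hx => hα0.trans_le hx.1)
    ⟨hβ.le, hα.le⟩
  have hγpos : 0 < γ := hα0.trans_le hγ.1
  exact ⟨γ, ⟨hγpos, hγ0⟩, fun γ' h => (strictAntiOn_coneProfile he hf hk hk').injOn h.1 hγpos
    (h.2.trans hγ0.symm)⟩

end Profile

/-! ### Principal values of integrable functions. -/

section PrincipalValue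

variable {V : Type*} [NormedAddCommGroup V] [MeasurableSpace V] [BorelSpace V] {μ : Measure V}

/-- Dominated convergence. Every ball of positive radius removes the origin, which `μ` may charge;
hence `h 0 = 0`. -/
theorem tendsto_setIntegral_compl_ball {h : V → ℝ} (hh : Integrable h μ) (h0 : h 0 = 0) :
    Tendsto (fun δ : ℝ => ∫ z in (Metric.ball 0 δ)ᶜ, h z ∂μ) (𝓝[>] 0) (𝓝 (∫ z, h z ∂μ)) := by
  have hm : ∀ δ : ℝ, MeasurableSet (Metric.ball (0 : V) δ)ᶜ := fun δ => measurableSet_ball.compl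
  simp only [← integral_indicator (hm _)]
  refine tendsto_integral_filter_of_dominated_convergence (fun z => ‖h z‖)
    (Eventually.of_forall fun δ => (hh.indicator (hm δ)).aestronglyMeasurable)
    (Eventually.of_forall fun δ => Eventually.of_forall fun z => norm_indicator_le_norm_self _ _)
    hh.norm (Eventually.of_forall fun z => ?_)
  by_cases hz : z = 0
  · have : ∀ δ : ℝ, (Metric.ball (0 : V) δ)ᶜ.indicator h z = h z := fun δ => by
      by_cases hm : z ∈ (Metric.ball (0 : V) δ)ᶜ
      · exact indicator_of_mem hm h
      · rw [indicator_of_notMem hm, hz, h0]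
    simp only [this]
    exact tendsto_const_nhds
  · refine tendsto_const_nhds.congr' ?_
    filter_upwards [Ioo_mem_nhdsGT (norm_pos_iff.2 hz)] with δ hδ
    rw [indicator_of_mem]
    simpa using hδ.2.le

end PrincipalValue

/-! ### Isometries and linear changes of variables. -/

section Isometry

variable {V : Type*} [NormedAddCommGroup V] [InnerProductSpace ℝ V]

theorem LinearIsometryEquiv.preimage_compl_ball_zero (R : V ≃ₗᵢ[ℝ] V) (δ : ℝ) :
    R ⁻¹' (Metric.ball 0 δ)ᶜ = (Metric.ball 0 δ)ᶜ := by
  ext z; simp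

theorem exists_linearIsometryEquiv_apply_eq {x y : V} (h : ‖x‖ = ‖y‖) :
    ∃ R : V ≃ₗᵢ[ℝ] V, R x = y :=
  ⟨_, Submodule.reflection_sub h⟩

variable [FiniteDimensional ℝ V] [MeasurableSpace V] [BorelSpace V]

theorem LinearIsometryEquiv.setIntegral_compl_ball_comp (R : V ≃ₗᵢ[ℝ] V) (g : V → ℝ) (δ : ℝ) :
    ∫ z in (Metric.ball 0 δ)ᶜ, g (R z) = ∫ z in (Metric.ball 0 δ)ᶜ, g z := by
  have := R.measurePreserving.setIntegral_preimage_emb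
    R.toHomeomorph.measurableEmbedding g (Metric.ball 0 δ)ᶜ
  rwa [R.preimage_compl_ball_zero] at this

theorem LinearIsometryEquiv.integrableOn_compl_ball_comp (R : V ≃ₗᵢ[ℝ] V) {g : V → ℝ} {δ : ℝ}
    (hg : IntegrableOn g (Metric.ball 0 δ)ᶜ) :
    IntegrableOn (fun z => g (R z)) (Metric.ball 0 δ)ᶜ := by
  have := (R.measurePreserving.integrableOn_comp_preimage
    R.toHomeomorph.measurableEmbedding (f := g) (s := (Metric.ball 0 δ)ᶜ)).2 hg
  rwa [R.preimage_compl_ball_zero] at this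

/-- A linear change of variables multiplies all integrals by the same positive constant. -/
theorem LinearEquiv.exists_pos_integral_comp_eq (T : V ≃ₗ[ℝ] V) :
    ∃ c : ℝ, 0 < c ∧ ∀ g : V → ℝ,
      (Integrable (fun z => g (T z)) → Integrable g) ∧ ∫ z, g z = c * ∫ z, g (T z) := by
  have hdet : LinearMap.det (T : V →ₗ[ℝ] V) ≠ 0 := T.isUnit_det'.ne_zero
  have hmap := Measure.map_linearMap_addHaar_eq_smul_addHaar (volume : Measure V) hdet
  have hemb : MeasurableEmbedding (T : V →ₗ[ℝ] V) :=
    T.toContinuousLinearEquiv.toHomeomorph.measurableEmbedding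
  have hpos : 0 < |(LinearMap.det (T : V →ₗ[ℝ] V))⁻¹| := by positivity
  refine ⟨|(LinearMap.det (T : V →ₗ[ℝ] V))⁻¹|⁻¹, by positivity, fun g => ⟨fun hg => ?_, ?_⟩⟩
  · have h := (hemb.integrable_map_iff (g := g)).2 hg
    rw [hmap] at h
    exact (integrable_smul_measure (by simpa using hpos) ENNReal.ofReal_ne_top).1 h
  · have h := hemb.integral_map (μ := volume) g
    rw [hmap, integral_smul_measure, ENNReal.toReal_ofReal hpos.le, smul_eq_mul] at h
    rw [eq_inv_mul_iff_mul_eq₀ hpos.ne', h]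
    rfl

end Isometry

/-! ### Reduction of the curvature to the profile. -/

section Curvature

variable {E F : Type*} [NormedAddCommGroup E] [NormedAddCommGroup F]

theorem norm_rpow_neg_scaling {k t α : ℝ} (ht : 0 < t) {z w : WithLp 2 (E × F)}
    (h1 : ‖w.fst‖ = t * ‖z.fst‖) (h2 : ‖w.snd‖ = α * t * ‖z.snd‖) :
    ‖w‖ ^ (-k) = (t ^ 2 * (1 + α ^ 2)) ^ (-(k / 2)) * coneKernel k α z := by
  have hpow : ‖w‖ ^ (-k) = (‖w‖ ^ 2) ^ (-(k / 2)) := by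
    rw [← Real.rpow_natCast, ← Real.rpow_mul (norm_nonneg _)]
    congr 1; push_cast; ring
  rw [hpow, coneKernel, ← Real.mul_rpow (by positivity) (by positivity),
    WithLp.prod_norm_sq_eq_of_L2, h1, h2]
  congr 1
  have : (1 + α ^ 2) ≠ 0 := by positivity
  field_simp

variable [InnerProductSpace ℝ E] [InnerProductSpace ℝ F]

theorem fracKernel_add_left (s α : ℝ) (p z : WithLp 2 (E × F)) :
    fracKernel s {x : WithLp 2 (E × F) | α * ‖x.fst‖ < ‖x.snd‖} p (p + z) =
      posSign (‖p.snd + z.snd‖ - α * ‖p.fst + z.fst‖) *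
        ‖z‖ ^ (-((Module.finrank ℝ (WithLp 2 (E × F)) : ℝ) + s)) := by
  rw [fracKernel, add_sub_cancel_left, Real.rpow_neg (norm_nonneg _), ← div_eq_mul_inv]
  congr 1
  by_cases h : α * ‖p.fst + z.fst‖ < ‖p.snd + z.snd‖
  · have h' : p + z ∈ {x : WithLp 2 (E × F) | α * ‖x.fst‖ < ‖x.snd‖} := h
    rw [posSign_of_pos (sub_pos.2 h), indicator_of_mem h',
      indicator_of_notMem (notMem_compl_iff.2 h'), sub_zero]
  · have h' : p + z ∉ {x : WithLp 2 (E × F) | α * ‖x.fst‖ < ‖x.snd‖} := h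
    rw [posSign_of_nonpos (sub_nonpos.2 (not_lt.1 h)), indicator_of_notMem h',
      indicator_of_mem (mem_compl h'), zero_sub]

/-- Any point of the cone is the image of the direction `(e, f)` under a linear map acting as a
similarity on each factor. -/
theorem exists_linearEquiv_symSign_comp {e : E} {f : F} (he : ‖e‖ = 1) (hf : ‖f‖ = 1) {α : ℝ}
    (hα : 0 < α) {a : E} {b : F} (ha : a ≠ 0) (hab : ‖b‖ = α * ‖a‖) :
    ∃ T : WithLp 2 (E × F) ≃ₗ[ℝ] WithLp 2 (E × F), ∀ z,
      ‖(T z).fst‖ = ‖a‖ * ‖z.fst‖ ∧ ‖(T z).snd‖ = α * ‖a‖ * ‖z.snd‖ ∧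
        symSign a b α (T z) = symSign e f 1 z := by
  have ht : 0 < ‖a‖ := norm_pos_iff.2 ha
  have hαt : 0 < α * ‖a‖ := by positivity
  -- `T` is an isometry taking `e` (resp. `f`) to the direction of `a` (resp. `b`), followed by
  -- dilation by `‖a‖` (resp. `α * ‖a‖`). The unequal dilations turn slope `α` into slope `1`.
  obtain ⟨R₁, hR₁⟩ := exists_linearIsometryEquiv_apply_eq (x := e) (y := ‖a‖⁻¹ • a) (by
    rw [he, norm_smul, norm_inv, norm_norm, inv_mul_cancel₀ ht.ne'])
  obtain ⟨R₂, hR₂⟩ := exists_linearIsometryEquiv_apply_eq (x := f) (y := (α * ‖a‖)⁻¹ • b) (by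
    rw [hf, norm_smul, hab, norm_inv, Real.norm_of_nonneg hαt.le, inv_mul_cancel₀ hαt.ne'])
  have ha' : a = ‖a‖ • R₁ e := by rw [hR₁, smul_inv_smul₀ ht.ne']
  have hb' : b = (α * ‖a‖) • R₂ f := by rw [hR₂, smul_inv_smul₀ hαt.ne']
  refine ⟨LinearEquiv.withLpCongr 2
    ((R₁.toLinearEquiv.trans (LinearEquiv.smulOfNeZero ℝ E ‖a‖ ht.ne')).prodCongr
      (R₂.toLinearEquiv.trans (LinearEquiv.smulOfNeZero ℝ F (α * ‖a‖) hαt.ne'))), fun z => ?_⟩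
  set w := LinearEquiv.withLpCongr 2
    ((R₁.toLinearEquiv.trans (LinearEquiv.smulOfNeZero ℝ E ‖a‖ ht.ne')).prodCongr
      (R₂.toLinearEquiv.trans (LinearEquiv.smulOfNeZero ℝ F (α * ‖a‖) hαt.ne'))) z with hw
  have h1 : w.fst = ‖a‖ • R₁ z.fst := rfl
  have h2 : w.snd = (α * ‖a‖) • R₂ z.snd := rfl
  refine ⟨by rw [h1, norm_smul, norm_norm, R₁.norm_map],
    by rw [h2, norm_smul, Real.norm_of_nonneg hαt.le, R₂.norm_map], ?_⟩
  have e1 : ‖a + w.fst‖ = ‖a‖ * ‖e + z.fst‖ := by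
    rw [h1]; nth_rw 1 [ha']
    rw [← smul_add, ← map_add, norm_smul, norm_norm, R₁.norm_map]
  have e2 : ‖a - w.fst‖ = ‖a‖ * ‖e - z.fst‖ := by
    rw [h1]; nth_rw 1 [ha']
    rw [← smul_sub, ← map_sub, norm_smul, norm_norm, R₁.norm_map]
  have e3 : ‖b + w.snd‖ = α * ‖a‖ * ‖f + z.snd‖ := by
    rw [h2]; nth_rw 1 [hb']
    rw [← smul_add, ← map_add, norm_smul, Real.norm_of_nonneg hαt.le, R₂.norm_map]
  have e4 : ‖b - w.snd‖ = α * ‖a‖ * ‖f - z.snd‖ := by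
    rw [h2]; nth_rw 1 [hb']
    rw [← smul_sub, ← map_sub, norm_smul, Real.norm_of_nonneg hαt.le, R₂.norm_map]
  have key : ∀ x y : ℝ, posSign (α * ‖a‖ * x - α * (‖a‖ * y)) = posSign (x - 1 * y) := fun x y =>
    posSign_congr (by
      rw [show α * ‖a‖ * x - α * (‖a‖ * y) = α * ‖a‖ * (x - 1 * y) by ring,
        mul_pos_iff_of_pos_left hαt])
  simp only [symSign, e1, e2, e3, e4, key]

variable [FiniteDimensional ℝ E] [FiniteDimensional ℝ F]
  [MeasurableSpace E] [BorelSpace E] [MeasurableSpace F] [BorelSpace F]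

/-- Symmetrization is done at fixed `δ`, where the kernel is integrable; only the symmetrized
integrand is then followed to `δ → 0`. -/
theorem setIntegral_posSign_eq_setIntegral_symSign (a : E) (b : F) (α : ℝ) {k δ : ℝ}
    (hk : (Module.finrank ℝ (WithLp 2 (E × F)) : ℝ) < k) (hδ : 0 < δ) :
    IntegrableOn (fun z : WithLp 2 (E × F) =>
      posSign (‖b + z.snd‖ - α * ‖a + z.fst‖) * ‖z‖ ^ (-k)) (Metric.ball 0 δ)ᶜ ∧
    ∫ z : WithLp 2 (E × F) in (Metric.ball 0 δ)ᶜ,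
        posSign (‖b + z.snd‖ - α * ‖a + z.fst‖) * ‖z‖ ^ (-k) =
      ∫ z : WithLp 2 (E × F) in (Metric.ball 0 δ)ᶜ, symSign a b α z * ‖z‖ ^ (-k) := by
  set g : WithLp 2 (E × F) → ℝ :=
    fun z => posSign (‖b + z.snd‖ - α * ‖a + z.fst‖) * ‖z‖ ^ (-k) with hg
  have hc : Continuous fun z : WithLp 2 (E × F) => ‖b + z.snd‖ - α * ‖a + z.fst‖ := by fun_prop
  have hgm : Measurable g :=
    (measurable_posSign.comp hc.measurable).mul (measurable_norm.pow_const _)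
  have hgi : IntegrableOn g (Metric.ball 0 δ)ᶜ := by
    refine (integrableOn_norm_rpow_compl_ball hk hδ).mono' hgm.aestronglyMeasurable
      (Eventually.of_forall fun z => ?_)
    rw [hg, norm_mul, Real.norm_of_nonneg (by positivity : 0 ≤ ‖z‖ ^ (-k))]
    exact mul_le_of_le_one_left (by positivity)
      (abs_le.2 ⟨neg_one_le_posSign _, posSign_le_one _⟩)
  refine ⟨hgi, ?_⟩
  set R₁ : WithLp 2 (E × F) ≃ₗᵢ[ℝ] WithLp 2 (E × F) :=
    LinearIsometryEquiv.withLpProdCongr 2 (LinearIsometryEquiv.neg ℝ)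
      (LinearIsometryEquiv.refl ℝ F) with hR₁
  set R₂ : WithLp 2 (E × F) ≃ₗᵢ[ℝ] WithLp 2 (E × F) :=
    LinearIsometryEquiv.withLpProdCongr 2 (LinearIsometryEquiv.refl ℝ E)
      (LinearIsometryEquiv.neg ℝ) with hR₂
  have h0 : ∀ z, symSign a b α z * ‖z‖ ^ (-k) =
      (g z + g (R₁ (R₂ z)) + g (R₁ z) + g (R₂ z)) / 4 := by
    intro z
    have n1 : (R₁ z).fst = -z.fst := rfl
    have n2 : (R₁ z).snd = z.snd := rfl
    have n3 : (R₂ z).fst = z.fst := rfl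
    have n4 : (R₂ z).snd = -z.snd := rfl
    have n5 : (R₁ (R₂ z)).fst = -z.fst := rfl
    have n6 : (R₁ (R₂ z)).snd = -z.snd := rfl
    simp only [hg, n1, n2, n3, n4, n5, n6, LinearIsometryEquiv.norm_map, ← sub_eq_add_neg, symSign]
    ring
  have i1 := R₁.integrableOn_compl_ball_comp hgi
  have i2 := R₂.integrableOn_compl_ball_comp hgi
  have i3 := R₂.integrableOn_compl_ball_comp i1
  have j1 := R₁.setIntegral_compl_ball_comp g δ
  have j2 := R₂.setIntegral_compl_ball_comp g δ
  have j3 := (R₂.setIntegral_compl_ball_comp (fun z => g (R₁ z)) δ).trans j1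
  simp only [h0]
  have i4 : IntegrableOn (fun z => g z + g (R₁ (R₂ z))) (Metric.ball 0 δ)ᶜ := hgi.add i3
  have i5 : IntegrableOn (fun z => g z + g (R₁ (R₂ z)) + g (R₁ z)) (Metric.ball 0 δ)ᶜ := i4.add i1
  rw [integral_div, integral_add i5 i2, integral_add i4 i1, integral_add hgi i3, j1, j2, j3]
  ring

/-- The fractional mean curvature of the cone `‖v‖ = α ‖u‖` exists at each of its points other
than the origin, and has the sign of `coneProfile`. -/
theorem exists_pos_hasFracMeanCurvature {e : E} {f : F} (he : ‖e‖ = 1) (hf : ‖f‖ = 1) {s α : ℝ}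
    (hs0 : 0 < s) (hs1 : s < 1) (hα : 0 < α) {p : WithLp 2 (E × F)} (hp : p ≠ 0)
    (hpα : ‖p.snd‖ = α * ‖p.fst‖) :
    ∃ c : ℝ, 0 < c ∧ HasFracMeanCurvature s {x : WithLp 2 (E × F) | α * ‖x.fst‖ < ‖x.snd‖} p
      (c * coneProfile e f ((Module.finrank ℝ (WithLp 2 (E × F)) : ℝ) + s) α) := by
  set k : ℝ := (Module.finrank ℝ (WithLp 2 (E × F)) : ℝ) + s with hk
  have hkN : (Module.finrank ℝ (WithLp 2 (E × F)) : ℝ) < k := by linarith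
  have hkN' : k < (Module.finrank ℝ (WithLp 2 (E × F)) : ℝ) + 1 := by linarith
  have hk0 : 0 < k := lt_of_le_of_lt (Nat.cast_nonneg _) hkN
  have ha : p.fst ≠ 0 := by
    intro h
    rw [h, norm_zero, mul_zero, norm_eq_zero] at hpα
    exact (fst_ne_zero_or_snd_ne_zero hp).elim (fun h' => h' h) (fun h' => h' hpα)
  have hta : 0 < ‖p.fst‖ := norm_pos_iff.2 ha
  obtain ⟨T, hT⟩ := exists_linearEquiv_symSign_comp he hf hα ha hpα
  obtain ⟨c, hc, hcT⟩ := T.exists_pos_integral_comp_eq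
  set h : WithLp 2 (E × F) → ℝ := fun z => symSign p.fst p.snd α z * ‖z‖ ^ (-k) with hh
  set c' : ℝ := (‖p.fst‖ ^ 2 * (1 + α ^ 2)) ^ (-(k / 2)) with hc'
  have hcomp : ∀ z, h (T z) = c' * (symSign e f 1 z * coneKernel k α z) := by
    intro z
    simp only [hh]
    rw [(hT z).2.2, norm_rpow_neg_scaling hta (hT z).1 (hT z).2.1]
    ring
  have hint : Integrable h := (hcT h).1 (by
    simp only [hcomp]
    exact (integrable_symSign_mul_coneKernel he hf hkN hkN' hα).const_mul c')
  have hval : ∫ z, h z = c * c' * coneProfile e f k α := by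
    rw [(hcT h).2]
    simp only [hcomp]
    rw [integral_const_mul, coneProfile, mul_assoc]
  have hh0 : h 0 = 0 := by
    simp only [hh, norm_zero]
    rw [Real.zero_rpow (by linarith), mul_zero]
  have hpre : ∀ δ : ℝ, (fun z => p + z) ⁻¹' (Metric.ball p δ)ᶜ = (Metric.ball 0 δ)ᶜ := fun δ => by
    ext z; simp
  have hmp := measurePreserving_add_left (volume : Measure (WithLp 2 (E × F))) p
  have hemb := measurableEmbedding_addLeft p
  refine ⟨c * c', by positivity, fun δ hδ => ?_, ?_⟩
  · rw [← hmp.integrableOn_comp_preimage hemb, hpre]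
    refine (setIntegral_posSign_eq_setIntegral_symSign p.fst p.snd α hkN hδ).1.congr_fun
      (fun z _ => (fracKernel_add_left s α p z).symm) measurableSet_ball.compl
  · rw [← hval]
    refine (tendsto_setIntegral_compl_ball hint hh0).congr' ?_
    filter_upwards [self_mem_nhdsWithin] with δ hδ
    have htr := hmp.setIntegral_preimage_emb hemb
      (fracKernel s {x : WithLp 2 (E × F) | α * ‖x.fst‖ < ‖x.snd‖} p) (Metric.ball p δ)ᶜ
    rw [hpre] at htr
    rw [← htr]
    simp only [fracKernel_add_left]
    exact (setIntegral_posSign_eq_setIntegral_symSign p.fst p.snd α hkN hδ).2.symm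

end Curvature

/-! ### Frontier and smoothness of the cone. -/

section Cone

variable {E F : Type*} [NormedAddCommGroup E] [NormedAddCommGroup F]

theorem isOpen_setOf_mul_norm_fst_lt (α : ℝ) :
    IsOpen {x : WithLp 2 (E × F) | α * ‖x.fst‖ < ‖x.snd‖} :=
  isOpen_lt (by fun_prop) (by fun_prop)

variable [InnerProductSpace ℝ E] [InnerProductSpace ℝ F]

theorem frontier_setOf_mul_norm_fst_lt {f : F} (hf : ‖f‖ = 1) (α : ℝ) :
    frontier {x : WithLp 2 (E × F) | α * ‖x.fst‖ < ‖x.snd‖} =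
      {x | ‖x.snd‖ = α * ‖x.fst‖} := by
  rw [(isOpen_setOf_mul_norm_fst_lt α).frontier_eq]
  have hcl : closure {x : WithLp 2 (E × F) | α * ‖x.fst‖ < ‖x.snd‖} =
      {x | α * ‖x.fst‖ ≤ ‖x.snd‖} := by
    refine Subset.antisymm (closure_lt_subset_le (by fun_prop) (by fun_prop)) fun x hx => ?_
    have hx' : α * ‖x.fst‖ ≤ ‖x.snd‖ := hx
    -- Moving along `(0, g)` lengthens the second component and fixes the first, so it enters the
    -- open cone at once. If `x.snd = 0` any unit direction works, whence the need for `f`.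
    obtain ⟨g, hg1, hg⟩ : ∃ g : F, ‖g‖ = 1 ∧ ‖x.snd‖ • g = x.snd := by
      by_cases h : x.snd = 0
      · exact ⟨f, hf, by rw [h, norm_zero, zero_smul]⟩
      · have h' : ‖x.snd‖ ≠ 0 := norm_ne_zero_iff.2 h
        exact ⟨‖x.snd‖⁻¹ • x.snd, by
          rw [norm_smul, norm_inv, norm_norm, inv_mul_cancel₀ h'], smul_inv_smul₀ h' _⟩
    set γ : ℝ → WithLp 2 (E × F) := fun t => x + t • WithLp.toLp 2 ((0 : E), g) with hγ
    have hγc : Continuous γ := by fun_prop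
    have hγ0 : γ 0 = x := by simp [hγ]
    have ht : Tendsto γ (𝓝[>] 0) (𝓝 x) := by
      have := hγc.continuousAt (x := (0 : ℝ)).tendsto
      rw [hγ0] at this
      exact this.mono_left nhdsWithin_le_nhds
    refine mem_closure_of_tendsto ht ?_
    filter_upwards [self_mem_nhdsWithin] with t ht
    have ht0 : (0 : ℝ) < t := ht
    have h1 : (γ t).fst = x.fst := by simp [hγ]
    have h2 : (γ t).snd = (‖x.snd‖ + t) • g := by
      simp only [hγ, WithLp.add_snd, WithLp.smul_snd, add_smul, hg, WithLp.toLp_snd]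
    show α * ‖(γ t).fst‖ < ‖(γ t).snd‖
    rw [h1, h2, norm_smul, hg1, mul_one, Real.norm_of_nonneg (by positivity)]
    linarith
  rw [hcl]
  ext x
  constructor
  · rintro ⟨h1, h2⟩
    exact le_antisymm (not_lt.1 h2) h1
  · intro h
    have h' : ‖x.snd‖ = α * ‖x.fst‖ := h
    exact ⟨h'.ge, h'.le.not_gt⟩

theorem hasSmoothBoundaryIn_setOf_mul_norm_fst_lt {f : F} (hf : ‖f‖ = 1) {α : ℝ} (hα : 0 < α) :
    HasSmoothBoundaryIn {x : WithLp 2 (E × F) | α * ‖x.fst‖ < ‖x.snd‖} {0}ᶜ := by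
  rintro p ⟨hp, hp0⟩
  rw [frontier_setOf_mul_norm_fst_lt hf] at hp
  have hp' : ‖p.snd‖ = α * ‖p.fst‖ := hp
  have hb : p.snd ≠ 0 := by
    intro h
    rw [h, norm_zero, zero_eq_mul, norm_eq_zero] at hp'
    exact (fst_ne_zero_or_snd_ne_zero hp0).elim (fun h' => h' (hp'.resolve_left hα.ne'))
      (fun h' => h' h)
  set g : WithLp 2 (E × F) → ℝ := fun x => ‖x.snd‖ ^ 2 - α ^ 2 * ‖x.fst‖ ^ 2 with hg
  have hfst : ContDiff ℝ ∞ fun x : WithLp 2 (E × F) => x.fst :=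
    (ContinuousLinearMap.fst ℝ E F ∘L
      (WithLp.prodContinuousLinearEquiv 2 ℝ E F).toContinuousLinearMap).contDiff
  have hsnd : ContDiff ℝ ∞ fun x : WithLp 2 (E × F) => x.snd :=
    (ContinuousLinearMap.snd ℝ E F ∘L
      (WithLp.prodContinuousLinearEquiv 2 ℝ E F).toContinuousLinearMap).contDiff
  have hgc : ContDiff ℝ ∞ g := (hsnd.norm_sq ℝ).sub (contDiff_const.mul (hfst.norm_sq ℝ))
  refine ⟨univ, g, isOpen_univ, mem_univ p, hgc.contDiffOn, fun hzero => ?_, fun x _ => ?_⟩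
  -- The derivative of `g` at `p` along `w` is `2 * ‖p.snd‖ ^ 2`, nonzero because the second
  -- component vanishes on the cone only at the origin.
  · set w : WithLp 2 (E × F) := WithLp.toLp 2 ((0 : E), p.snd) with hw
    have hd : HasDerivAt (fun t : ℝ => p + t • w) w 0 := by
      simpa using ((hasDerivAt_id (0 : ℝ)).smul_const w).const_add p
    have hgd : HasFDerivAt g (fderiv ℝ g p) (p + (0 : ℝ) • w) := by
      rw [zero_smul, add_zero]
      exact (hgc.differentiable (by simp) p).hasFDerivAt
    have h1 := hgd.comp_hasDerivAt (0 : ℝ) hd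
    have h2 : g ∘ (fun t : ℝ => p + t • w) =
        fun t => (1 + t) ^ 2 * ‖p.snd‖ ^ 2 - α ^ 2 * ‖p.fst‖ ^ 2 := by
      funext t
      have e1 : (p + t • w).fst = p.fst := by simp [hw]
      have e2 : (p + t • w).snd = (1 + t) • p.snd := by simp [hw, add_smul]
      simp only [Function.comp, hg, e1, e2, norm_smul, mul_pow, Real.norm_eq_abs, sq_abs]
    have h3 : HasDerivAt (fun t : ℝ => (1 + t) ^ 2 * ‖p.snd‖ ^ 2 - α ^ 2 * ‖p.fst‖ ^ 2)
        (2 * ‖p.snd‖ ^ 2) 0 := by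
      simpa using ((((hasDerivAt_id (0 : ℝ)).const_add 1).pow 2).mul_const (‖p.snd‖ ^ 2)).sub_const
        (α ^ 2 * ‖p.fst‖ ^ 2)
    rw [h2, hzero] at h1
    have h4 := h3.unique h1
    have h5 : 0 < ‖p.snd‖ := norm_pos_iff.2 hb
    simp only [zero_apply] at h4
    nlinarith [pow_pos h5 2]
  · show α * ‖x.fst‖ < ‖x.snd‖ ↔ 0 < ‖x.snd‖ ^ 2 - α ^ 2 * ‖x.fst‖ ^ 2
    rw [sub_pos, ← mul_pow, sq_lt_sq₀ (by positivity) (norm_nonneg _)]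

end Cone

/-! ### Conclusion for Lawson cones. -/

theorem theorem3 (m n : ℕ) (hm : 1 ≤ m) (hn : 1 ≤ n) (s : ℝ) (hs0 : 0 < s) (hs1 : s < 1) :
    (∀ α : ℝ, 0 < α → frontier (solidCone m n α) = lawsonCone m n α) ∧
    ∃! α : ℝ, 0 < α ∧ IsFracMinimalBoundaryIn s (solidCone m n α) {0}ᶜ := by
  obtain ⟨e, he⟩ : ∃ e : EuclideanSpace ℝ (Fin m), ‖e‖ = 1 :=
    ⟨EuclideanSpace.single ⟨0, hm⟩ 1, by simp⟩
  obtain ⟨f, hf⟩ : ∃ f : EuclideanSpace ℝ (Fin n), ‖f‖ = 1 :=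
    ⟨EuclideanSpace.single ⟨0, hn⟩ 1, by simp⟩
  have hfr : ∀ α : ℝ, frontier (solidCone m n α) = lawsonCone m n α :=
    fun α => frontier_setOf_mul_norm_fst_lt hf α
  refine ⟨fun α _ => hfr α, ?_⟩
  set N : ℝ := (Module.finrank ℝ (EucProd m n) : ℝ) with hN
  have key : ∀ α : ℝ, 0 < α →
      (IsFracMinimalBoundaryIn s (solidCone m n α) {0}ᶜ ↔ coneProfile e f (N + s) α = 0) := by
    intro α hα
    constructor
    · intro h
      -- One nonzero cone point suffices: the limit there is unique and is a positive multiple of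
      -- the profile.
      set p : EucProd m n := WithLp.toLp 2 (e, α • f) with hp
      have hpα : ‖p.snd‖ = α * ‖p.fst‖ := by
        simp [hp, norm_smul, he, hf, hα.le]
      have hp0 : p ≠ 0 := by
        intro h0
        have h1 : p.fst = 0 := by rw [h0]; rfl
        have h2 : e = 0 := h1
        rw [h2, norm_zero] at he
        exact zero_ne_one he
      obtain ⟨c, hc, hcurv⟩ := exists_pos_hasFracMeanCurvature he hf hs0 hs1 hα hp0 hpα
      have h0 := h.curvature_eq_zero p ⟨by rw [hfr]; exact hpα, hp0⟩
      exact (mul_eq_zero.1 (tendsto_nhds_unique hcurv.2 h0.2)).resolve_left hc.ne'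
    · intro h
      refine ⟨isOpen_setOf_mul_norm_fst_lt α, hasSmoothBoundaryIn_setOf_mul_norm_fst_lt hf hα, ?_⟩
      rintro p ⟨hp, hp0⟩
      rw [hfr] at hp
      obtain ⟨c, _, hcurv⟩ := exists_pos_hasFracMeanCurvature he hf hs0 hs1 hα hp0 hp
      rw [h, mul_zero] at hcurv
      exact hcurv
  obtain ⟨α, ⟨hα, hα0⟩, huniq⟩ := existsUnique_coneProfile_eq_zero he hf (k := N + s)
    (by linarith) (by linarith)
  exact ⟨α, ⟨hα, (key α hα).2 hα0⟩, fun β hβ => huniq β ⟨hβ.1, (key β hβ.1).1 hβ.2⟩⟩
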